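/- All graphs are finite, simple and undirected. For a connected graph $G$ with at least two vertices and vertices $x,y$ put $R\{x,y\}=\{z\in V(G): d(x,z)\neq d(y,z)\}$ and $\kappa(G)=\min\{|R\{x,y\}|: x,y\in V(G),\ x\neq y\}$. For a real number $k\in[1,\kappa(G)]$, a function $g:V(G)\to[0,1]$ is a $k$-resolving function of $G$ if $\sum_{z\in R\{x,y\}}g(z)\ge k$ for all distinct $x,y\in V(G)$, and $\dim_f^k(G)$ is the minimum of $\sum_{v\in V(G)}g(v)$ over all $k$-resolving functions $g$ of $G$. A major vertex is a vertex of degree at least $3$, and a leaf is a vertex of degree $1$. A leaf $u$ is a terminal vertex of a major vertex $v$ if $d(u,v)<d(u,w)$ for every major vertex $w\ne v$. The terminal degree of a major vertex is the number of its terminal vertices, and an exterior major vertex is a major vertex of positive terminal degree. For a tree $T$, let $\mathcal M(T)$, $\mathcal M_2(T)$ and $\mathcal M_3(T)$ be the sets of exterior major vertices of terminal degree at least $2$, exactly $2$ and at least $3$, respectively. For $v\in\mathcal M(T)$, let $T_v$ be the subtree of $T$ induced by $v$ and all vertices belonging to the paths joining $v$ with its terminal vertices. Theorem. Let $T$ be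 a tree with at least one exterior major vertex. Then $$\kappa(T)=\min\{\kappa(T_v): v\in\mathcal M(T)\},$$ and, for every real number $k\in[1,\kappa(T)]$, $$\dim_f^k(T)=k\,|\mathcal M_2(T)|+\sum_{v\in\mathcal M_3(T)}\dim_f^k(T_v).$$ -/

import Mathlib

namespace FracKDim

variable {V : Type*} [Fintype V]

/-- `R{x, y}`: the vertices `z` with `d(x, z) ≠ d(y, z)`. -/
noncomputable def resolvers (G : SimpleGraph V) (x y : V) : Finset V :=
  Finset.univ.filter fun z => G.dist x z ≠ G.dist y z

/-- `κ(G)`: the minimum of `|R{x, y}|` over all pairs of distinct vertices. -/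
noncomputable def kappa (G : SimpleGraph V) : ℕ :=
  sInf {n | ∃ x y : V, x ≠ y ∧ (resolvers G x y).card = n}

/-- `g : V → [0, 1]` is a `k`-resolving function of `G`. -/
def IsKResolving (G : SimpleGraph V) (k : ℝ) (g : V → ℝ) : Prop :=
  (∀ v, g v ∈ Set.Icc (0 : ℝ) 1) ∧ ∀ x y : V, x ≠ y → k ≤ ∑ z ∈ resolvers G x y, g z

/-- The fractional `k`-metric dimension: the minimum of `g(V)` over the `k`-resolving
functions `g` of `G` (the minimum is attained whenever `k ≤ κ(G)`, see
`isLeast_fracKDim`). -/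
noncomputable def fracKDim (G : SimpleGraph V) (k : ℝ) : ℝ :=
  sInf ((fun g : V → ℝ => ∑ v, g v) '' {g | IsKResolving G k g})

theorem isLeast_kappa [Nontrivial V] (G : SimpleGraph V) :
    IsLeast {n | ∃ x y : V, x ≠ y ∧ (resolvers G x y).card = n} (kappa G) := by
  obtain ⟨x, y, h⟩ := exists_pair_ne V
  exact ⟨Nat.sInf_mem ⟨_, x, y, h, rfl⟩, fun n hn => Nat.sInf_le hn⟩

theorem isLeast_fracKDim (G : SimpleGraph V) {k : ℝ} (hk : k ≤ kappa G) :
    IsLeast ((fun g : V → ℝ => ∑ v, g v) '' {g | IsKResolving G k g}) (fracKDim G k) := by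
  have hne : {g : V → ℝ | IsKResolving G k g}.Nonempty := by
    refine ⟨fun _ => 1, fun _ => by simp, fun x y hxy => ?_⟩
    have h : kappa G ≤ (resolvers G x y).card := Nat.sInf_le ⟨x, y, hxy, rfl⟩
    have h' : (kappa G : ℝ) ≤ (resolvers G x y).card := by exact_mod_cast h
    simpa using hk.trans h'
  have hc : IsCompact {g : V → ℝ | IsKResolving G k g} := by
    have h1 : IsCompact (Set.univ.pi fun _ : V => Set.Icc (0 : ℝ) 1) :=
      isCompact_univ_pi fun _ => isCompact_Icc
    have h2 : IsClosed {g : V → ℝ | ∀ x y : V, x ≠ y → k ≤ ∑ z ∈ resolvers G x y, g z} := by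
      simp only [Set.ofPred_forall]
      refine isClosed_iInter fun x => isClosed_iInter fun y => isClosed_iInter fun _ => ?_
      exact isClosed_le continuous_const (by fun_prop)
    convert h1.inter_right h2 using 1
    ext g
    exact and_congr_left fun _ => Set.mem_univ_pi.symm
  exact (hc.image (by fun_prop)).isLeast_sInf (hne.image _)

open Classical in
/-- A major vertex: degree at least three. -/
def IsMajor (G : SimpleGraph V) (v : V) : Prop := 3 ≤ G.degree v

open Classical in
/-- A leaf: degree one. -/
def IsLeaf (G : SimpleGraph V) (v : V) : Prop := G.degree v = 1

/-- The leaf `u` is a terminal vertex of the major vertex `v`: it is strictly closer to `v`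
than to every other major vertex. -/
def IsTerminal (G : SimpleGraph V) (u v : V) : Prop :=
  IsLeaf G u ∧ IsMajor G v ∧ ∀ w, IsMajor G w → w ≠ v → G.dist u v < G.dist u w

open Classical in
/-- The terminal degree of `v`. -/
noncomputable def terminalDegree (G : SimpleGraph V) (v : V) : ℕ :=
  (Finset.univ.filter fun u => IsTerminal G u v).card

open Classical in
/-- The exterior major vertices: the major vertices of positive terminal degree. -/
noncomputable def exteriorMajor (G : SimpleGraph V) : Finset V :=
  Finset.univ.filter fun v => IsMajor G v ∧ 0 < terminalDegree G v

/-- `𝓜(G)`: the exterior major vertices of terminal degree greater than one. -/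
noncomputable def exteriorM (G : SimpleGraph V) : Finset V :=
  (exteriorMajor G).filter fun v => 1 < terminalDegree G v

/-- `𝓜₂(G)`: the members of `𝓜(G)` of terminal degree two. -/
noncomputable def exteriorM₂ (G : SimpleGraph V) : Finset V :=
  (exteriorM G).filter fun v => terminalDegree G v = 2

/-- `𝓜₃(G)`: the members of `𝓜(G)` of terminal degree at least three. -/
noncomputable def exteriorM₃ (G : SimpleGraph V) : Finset V :=
  (exteriorM G).filter fun v => 3 ≤ terminalDegree G v

open Classical in
/-- The vertex set of `T_v`: `v` and all vertices on the paths joining `v` with its terminal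
vertices. -/
noncomputable def legVerts (G : SimpleGraph V) (v : V) : Finset V :=
  Finset.univ.filter fun x =>
    x = v ∨ ∃ u, IsTerminal G u v ∧ ∃ p : G.Walk v u, p.IsPath ∧ x ∈ p.support

/-- `T_v`: the subgraph of `G` induced by `legVerts G v`. -/
def legTree (G : SimpleGraph V) (v : V) : SimpleGraph (legVerts G v) :=
  G.induce (legVerts G v : Set V)

end FracKDim

/-! Call a branch at `v` a leg if it contains no major vertex. Legs at a major vertex `v` are paths,
one for each terminal vertex of `v`, and `T_v` is `v` with its legs. For the roots `a`, `b` of two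
legs at `v`, R{a, b} is exactly the union of the two legs (`resolvers_adj`). Conversely, every R{x,
y} contains two legs of a common major vertex (`exists_legs_subset_resolvers`). So only pairs of leg
roots matter, both for κ and for the constraints on `g`; as legs of distinct major vertices are
disjoint (`disjoint_legs`), the optimisation splits over `v ∈ 𝓜(T)`.

At terminal degree two there is one constraint, of optimal value `k`. At terminal degree at least
three the constraints amount to those of `T_v`: a pair in `T_v` is resolved by two legs of `v`, or
by everything except at most one leg vertex, which leaves two legs untouched. With only two legs
this fails: `T_v` is a path, and the two neighbours of a leg vertex give a constraint that omits it.
-/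

namespace FracKDim

variable {V : Type*} {T : SimpleGraph V}

open SimpleGraph

/-! ### Distances and geodesics in a tree -/

/-- Moving along an edge towards `z` shortens the distance to `z` by exactly one. -/
theorem dist_eq_add_one_of_lt {u v z : V} (huv : T.Adj u v) (h : T.dist v z < T.dist u z) :
    T.dist u z = T.dist v z + 1 := by
  have := huv.diff_dist_adj (u := z)
  simp only [T.dist_comm (u := z)] at this
  omega

theorem dist_lt_or_lt (hT : T.IsTree) {u v : V} (huv : T.Adj u v) (z : V) :
    T.dist u z < T.dist v z ∨ T.dist v z < T.dist u z := by
  have := hT.dist_ne_of_adj z huv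
  simp only [T.dist_comm (u := z)] at this
  omega

theorem exists_adj_dist_lt (hT : T.IsTree) {u z : V} (h : u ≠ z) :
    ∃ v, T.Adj u v ∧ T.dist v z < T.dist u z := by
  obtain ⟨p, hp⟩ := hT.connected.exists_walk_length_eq_dist u z
  cases p with
  | nil => exact absurd rfl h
  | cons ha q =>
    refine ⟨_, ha, ?_⟩
    rw [← hp, Walk.length_cons]
    exact Nat.lt_succ_of_le (dist_le q)

/-- Otherwise geodesics through `a` and `b` would be two different paths from `m` to `z`. -/
theorem eq_of_dist_lt (hT : T.IsTree) {m a b z : V} (ha : T.Adj m a) (hb : T.Adj m b)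
    (haz : T.dist a z < T.dist m z) (hbz : T.dist b z < T.dist m z) : a = b := by
  obtain ⟨p, hp⟩ := hT.connected.exists_walk_length_eq_dist a z
  obtain ⟨q, hq⟩ := hT.connected.exists_walk_length_eq_dist b z
  have h1 := Walk.isPath_of_length_eq_dist (Walk.cons ha p)
    (by rw [Walk.length_cons, hp, dist_eq_add_one_of_lt ha haz])
  have h2 := Walk.isPath_of_length_eq_dist (Walk.cons hb q)
    (by rw [Walk.length_cons, hq, dist_eq_add_one_of_lt hb hbz])
  have h := (hT.existsUnique_path m z).unique h1 h2
  simp only [Walk.cons.injEq] at h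
  exact h.1

/-- If the edge from `m` to `b` leads towards `y` and away from `z`, then `m` lies between. -/
theorem dist_eq_add_of_lt_of_lt (hT : T.IsTree) {m b y z : V} (hb : T.Adj m b)
    (hy : T.dist b y < T.dist m y) (hz : T.dist m z < T.dist b z) :
    T.dist z y = T.dist z m + T.dist m y := by
  induction h : T.dist m y generalizing m b with
  | zero => omega
  | succ n ih =>
    have hby := dist_eq_add_one_of_lt hb hy
    have hbz := dist_eq_add_one_of_lt hb.symm hz
    have c1 : T.dist z m = T.dist m z := T.dist_comm
    have c2 : T.dist z b = T.dist b z := T.dist_comm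
    by_cases hbe : b = y
    · subst hbe
      rw [T.dist_self] at hby
      omega
    obtain ⟨c, hc, hcy⟩ := exists_adj_dist_lt hT hbe
    -- The edge advances one step towards `y`. If `c` were nearer to `z` than `b`, it would equal
    -- `m`, which is farther from `y` than `b`.
    have hcz : T.dist b z < T.dist c z := by
      rcases dist_lt_or_lt hT hc z with h' | h'
      · exact h'
      · obtain rfl := eq_of_dist_lt hT hc hb.symm h' hz
        omega
    have := ih hc hcy hcz (by omega)
    omega

/-- On the path from `v` to `u`, the distances add up. -/
theorem mem_support_iff_dist (hT : T.IsTree) {v u x : V} :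
    (∃ p : T.Walk v u, p.IsPath ∧ x ∈ p.support) ↔ T.dist v x + T.dist x u = T.dist v u := by
  classical
  constructor
  · rintro ⟨p, hp, hx⟩
    obtain ⟨q, hq, hql⟩ := hT.connected.exists_path_of_dist v u
    obtain rfl := (hT.existsUnique_path v u).unique hp hq
    have h1 := congrArg Walk.length (p.take_spec hx)
    rw [Walk.length_append] at h1
    have h2 := dist_le (p.takeUntil x hx)
    have h3 := dist_le (p.dropUntil x hx)
    have h4 := hT.connected.dist_triangle (u := v) (v := x) (w := u)
    omega
  · intro h
    obtain ⟨p, hp⟩ := hT.connected.exists_walk_length_eq_dist v x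
    obtain ⟨q, hq⟩ := hT.connected.exists_walk_length_eq_dist x u
    refine ⟨p.append q, Walk.isPath_of_length_eq_dist _ ?_, ?_⟩
    · rw [Walk.length_append]
      omega
    · rw [Walk.mem_support_append_iff]
      exact Or.inl p.end_mem_support

/-! ### Branches and resolving sets -/

/-- The vertices closer to `a` than to `v`: for adjacent `v` and `a` in a tree, the component
of `a` after deleting `v`. -/
noncomputable def branch [Fintype V] (G : SimpleGraph V) (v a : V) : Finset V :=
  Finset.univ.filter fun z => G.dist a z < G.dist v z

variable [Fintype V]

@[simp]
theorem mem_branch {G : SimpleGraph V} {v a z : V} :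
    z ∈ branch G v a ↔ G.dist a z < G.dist v z := by
  simp [branch]

@[simp]
theorem mem_resolvers {G : SimpleGraph V} {x y z : V} :
    z ∈ resolvers G x y ↔ G.dist x z ≠ G.dist y z := by
  simp [resolvers]

theorem notMem_branch (hT : T.IsTree) {v a z : V} (h : T.Adj v a) :
    z ∉ branch T v a ↔ T.dist v z < T.dist a z := by
  rw [mem_branch]
  have := dist_lt_or_lt hT h z
  omega

theorem self_mem_branch {v a : V} (h : T.Adj v a) : a ∈ branch T v a := by
  rw [mem_branch, T.dist_self, dist_eq_one_iff_adj.2 h]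
  exact one_pos

theorem center_notMem_branch {v a : V} : v ∉ branch T v a := by
  simp

theorem exists_mem_branch (hT : T.IsTree) {v z : V} (h : v ≠ z) :
    ∃ a, T.Adj v a ∧ z ∈ branch T v a := by
  simpa using exists_adj_dist_lt hT h

theorem eq_of_mem_branch (hT : T.IsTree) {m a b z : V} (ha : T.Adj m a) (hb : T.Adj m b)
    (haz : z ∈ branch T m a) (hbz : z ∈ branch T m b) : a = b :=
  eq_of_dist_lt hT ha hb (mem_branch.1 haz) (mem_branch.1 hbz)

theorem dist_eq_add_of_mem_branch (hT : T.IsTree) {m b y z : V} (hb : T.Adj m b)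
    (hy : y ∈ branch T m b) (hz : z ∉ branch T m b) :
    T.dist z y = T.dist z m + T.dist m y :=
  dist_eq_add_of_lt_of_lt hT hb (mem_branch.1 hy) ((notMem_branch hT hb).1 hz)

/-- The vertices of a branch other than its root lie on further branches at the root. -/
theorem exists_mem_branch_of_ne (hT : T.IsTree) {v a z : V}
    (hz : z ∈ branch T v a) (hne : a ≠ z) :
    ∃ b, T.Adj a b ∧ b ≠ v ∧ z ∈ branch T a b := by
  obtain ⟨b, hb, hzb⟩ := exists_mem_branch hT hne
  refine ⟨b, hb, ?_, hzb⟩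
  rintro rfl
  rw [mem_branch] at hz hzb
  omega

/-- Paths from `v` into the branch at `c` pass through `w`, and starting from `a` already shortens
the part up to `w`. -/
theorem branch_subset_branch (hT : T.IsTree) {v a w c : V} (hc : T.Adj w c)
    (hw : w ∈ branch T v a) (hv : v ∉ branch T w c) : branch T w c ⊆ branch T v a := by
  intro z hz
  have h1 := dist_eq_add_of_mem_branch hT hc hz hv
  have h2 := hT.connected.dist_triangle (u := a) (v := w) (w := z)
  rw [mem_branch] at hw ⊢
  omega

/-- A neighbour of a vertex of a branch is on that branch, or the vertex it hangs from. -/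
theorem eq_or_mem_branch_of_adj (hT : T.IsTree) {v a x c : V} (ha : T.Adj v a)
    (hx : x ∈ branch T v a) (hc : T.Adj x c) : c = v ∨ c ∈ branch T v a := by
  by_contra! h
  have h1 := dist_eq_add_of_mem_branch hT ha hx h.2
  have h2 : T.dist c x = 1 := dist_eq_one_iff_adj.2 hc.symm
  have h3 := hT.connected.pos_dist_of_ne h.1
  rw [mem_branch] at hx
  omega

/-- Outside both branches `a` and `b` are equally far, both reached through `v`; inside one branch
its root is nearer than `v` and the other root farther. -/
theorem resolvers_adj (hT : T.IsTree) [DecidableEq V] {v a b : V} (ha : T.Adj v a)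
    (hb : T.Adj v b) (hab : a ≠ b) : resolvers T a b = branch T v a ∪ branch T v b := by
  ext z
  rw [mem_resolvers, Finset.mem_union]
  constructor
  · intro h
    by_contra! hn
    rw [notMem_branch hT ha, notMem_branch hT hb] at hn
    have h1 := dist_eq_add_one_of_lt ha.symm hn.1
    have h2 := dist_eq_add_one_of_lt hb.symm hn.2
    omega
  · rintro (h | h)
    · have h' : z ∉ branch T v b := fun h' => hab (eq_of_mem_branch hT ha hb h h')
      rw [notMem_branch hT hb] at h'
      rw [mem_branch] at h
      omega
    · have h' : z ∉ branch T v a := fun h' => hab (eq_of_mem_branch hT ha hb h' h)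
      rw [notMem_branch hT ha] at h'
      rw [mem_branch] at h
      omega

/-- Two vertices are resolved by all vertices, or by the branches towards them at a third
vertex. -/
theorem branches_subset_resolvers (hT : T.IsTree) [DecidableEq V] {x y : V} (hxy : x ≠ y) :
    (∀ z, z ∈ resolvers T x y) ∨ ∃ m a b, T.Adj m a ∧ T.Adj m b ∧ a ≠ b ∧
      x ∈ branch T m a ∧ y ∈ branch T m b ∧
      branch T m a ∪ branch T m b ⊆ resolvers T x y := by
  rw [or_iff_not_imp_left]
  intro hne
  classical
  -- A vertex equidistant from `x` and `y` at the least distance is the midpoint of their path.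
  have hex : ∃ n m, T.dist x m = n ∧ T.dist y m = n := by
    push Not at hne
    obtain ⟨z, hz⟩ := hne
    rw [mem_resolvers, not_not] at hz
    exact ⟨_, z, rfl, hz.symm⟩
  obtain ⟨m, hmx, hmy⟩ := Nat.find_spec hex
  set s := Nat.find hex with hs
  have hmin : ∀ m', T.dist x m' = T.dist y m' → s ≤ T.dist x m' := fun m' h =>
    Nat.find_min' hex ⟨m', rfl, h.symm⟩
  have cx : T.dist m x = s := T.dist_comm.trans hmx
  have cy : T.dist m y = s := T.dist_comm.trans hmy
  have hs0 : s ≠ 0 := by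
    intro h0
    rw [h0] at hmx hmy
    rw [hT.connected.dist_eq_zero_iff] at hmx hmy
    exact hxy (hmx.trans hmy.symm)
  have hnx : m ≠ x := by
    rintro rfl
    rw [T.dist_self] at hmx
    omega
  have hny : m ≠ y := by
    rintro rfl
    rw [T.dist_self] at hmy
    omega
  obtain ⟨a, ha, hxa⟩ := exists_mem_branch hT hnx
  obtain ⟨b, hb, hyb⟩ := exists_mem_branch hT hny
  have hxa' := dist_eq_add_one_of_lt ha (mem_branch.1 hxa)
  have hyb' := dist_eq_add_one_of_lt hb (mem_branch.1 hyb)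
  -- A common first step would be equidistant too, and nearer.
  have hab : a ≠ b := by
    rintro rfl
    have c1 : T.dist x a = T.dist a x := T.dist_comm
    have c2 : T.dist y a = T.dist a y := T.dist_comm
    have := hmin a (by omega)
    omega
  refine ⟨m, a, b, ha, hb, hab, hxa, hyb, ?_⟩
  intro z hz
  rw [mem_resolvers]
  have cz : T.dist z m = T.dist m z := T.dist_comm
  rcases Finset.mem_union.1 hz with h | h
  · have h1 := dist_eq_add_of_mem_branch hT hb hyb
      (fun h' => hab (eq_of_mem_branch hT ha hb h h'))
    have h2 := hT.connected.dist_triangle (u := x) (v := a) (w := z)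
    have c1 : T.dist x a = T.dist a x := T.dist_comm
    have c2 : T.dist z y = T.dist y z := T.dist_comm
    rw [mem_branch] at h
    omega
  · have h1 := dist_eq_add_of_mem_branch hT ha hxa
      (fun h' => hab (eq_of_mem_branch hT ha hb h' h))
    have h2 := hT.connected.dist_triangle (u := y) (v := b) (w := z)
    have c1 : T.dist y b = T.dist b y := T.dist_comm
    have c2 : T.dist z x = T.dist x z := T.dist_comm
    rw [mem_branch] at h
    omega

/-! ### Major vertices, leaves and legs -/

theorem eq_or_eq_of_not_isMajor {G : SimpleGraph V} {m a b c : V} (h : ¬ IsMajor G m)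
    (ha : G.Adj m a) (hb : G.Adj m b) (hc : G.Adj m c) (hab : a ≠ b) : c = a ∨ c = b := by
  classical
  by_contra! hn
  refine h ?_
  unfold IsMajor
  rw [← G.card_neighborFinset_eq_degree]
  refine Finset.two_lt_card.2 ⟨a, ?_, b, ?_, c, ?_, hab, hn.1.symm, hn.2.symm⟩ <;>
    simpa

theorem IsMajor.exists_adj_ne {G : SimpleGraph V} {w : V} (h : IsMajor G w) (p : V) :
    ∃ a b, G.Adj w a ∧ G.Adj w b ∧ a ≠ b ∧ a ≠ p ∧ b ≠ p := by
  classical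
  unfold IsMajor at h
  rw [← G.card_neighborFinset_eq_degree] at h
  have h1 : 1 < ((G.neighborFinset w).erase p).card := by
    have := Finset.pred_card_le_card_erase (s := G.neighborFinset w) (a := p)
    omega
  obtain ⟨a, ha, b, hb, hab⟩ := Finset.one_lt_card.1 h1
  simp only [Finset.mem_erase, mem_neighborFinset] at ha hb
  exact ⟨a, b, ha.2, hb.2, hab, ha.1, hb.1⟩

theorem IsLeaf.eq_of_adj {G : SimpleGraph V} {u a b : V} (h : IsLeaf G u) (ha : G.Adj u a)
    (hb : G.Adj u b) : a = b := by
  classical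
  unfold IsLeaf at h
  rw [← G.card_neighborFinset_eq_degree] at h
  exact Finset.card_le_one.1 h.le a (by simpa) b (by simpa)

theorem isLeaf_of_forall_eq {G : SimpleGraph V} {u a : V} (ha : G.Adj u a)
    (h : ∀ b, G.Adj u b → b = a) : IsLeaf G u := by
  classical
  unfold IsLeaf
  rw [← G.card_neighborFinset_eq_degree, Finset.card_eq_one]
  refine ⟨a, Finset.ext fun b => ?_⟩
  rw [mem_neighborFinset, Finset.mem_singleton]
  exact ⟨h b, fun hb => hb ▸ ha⟩

theorem IsLeaf.not_isMajor {G : SimpleGraph V} {u : V} (h : IsLeaf G u) : ¬ IsMajor G u := by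
  unfold IsLeaf at h
  unfold IsMajor
  omega

open Classical in
/-- The neighbours of `v` whose branch contains no major vertex. -/
noncomputable def legRoots (G : SimpleGraph V) (v : V) : Finset V :=
  Finset.univ.filter fun a => G.Adj v a ∧ ∀ w ∈ branch G v a, ¬ IsMajor G w

theorem mem_legRoots {G : SimpleGraph V} {v a : V} :
    a ∈ legRoots G v ↔ G.Adj v a ∧ ∀ w ∈ branch G v a, ¬ IsMajor G w := by
  simp [legRoots]

theorem adj_of_mem_legRoots {G : SimpleGraph V} {v a : V} (h : a ∈ legRoots G v) : G.Adj v a :=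
  (mem_legRoots.1 h).1

open Classical in
/-- The union of the legs at `v`. -/
noncomputable def legs (G : SimpleGraph V) (v : V) : Finset V :=
  (legRoots G v).biUnion (branch G v)

theorem mem_legs {G : SimpleGraph V} {v z : V} :
    z ∈ legs G v ↔ ∃ a ∈ legRoots G v, z ∈ branch G v a := by
  simp only [legs, Finset.mem_biUnion]

/-- A branch without major vertices is a path: its vertices are linearly ordered by their
distance from `v`. -/
theorem dist_add_of_branch_not_isMajor (hT : T.IsTree) {v a x y : V} (ha : T.Adj v a)
    (hm : ∀ w ∈ branch T v a, ¬ IsMajor T w) (hx : x ∈ branch T v a) (hy : y ∈ branch T v a)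
    (hxy : T.dist v x ≤ T.dist v y) : T.dist v y = T.dist v x + T.dist x y := by
  induction h : T.dist v x generalizing v a with
  | zero => simp at hx; omega
  | succ n ih =>
    have hx' := dist_eq_add_one_of_lt ha (mem_branch.1 hx)
    have hy' := dist_eq_add_one_of_lt ha (mem_branch.1 hy)
    by_cases hax : a = x
    · subst hax
      rw [T.dist_self] at hx'
      omega
    have hay : a ≠ y := by
      rintro rfl
      have := hT.connected.pos_dist_of_ne hax
      rw [T.dist_self] at hy'
      omega
    obtain ⟨b, hb, hbv, hxb⟩ := exists_mem_branch_of_ne hT hx hax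
    obtain ⟨c, hc, hcv, hyc⟩ := exists_mem_branch_of_ne hT hy hay
    -- As `a` is not major and is adjacent to `v`, it has only one way onward.
    obtain rfl : b = c :=
      ((eq_or_eq_of_not_isMajor (hm a (self_mem_branch ha)) ha.symm hb hc hbv.symm).resolve_left
        hcv).symm
    have hv : v ∉ branch T a b := fun h' =>
      hbv (eq_of_mem_branch hT ha.symm hb (self_mem_branch ha.symm) h').symm
    have := ih hb (fun w hw => hm w (branch_subset_branch hT hb (self_mem_branch ha) hv hw))
      hxb hyc (by omega) (by omega)
    omega

/-- The end of a leg is a terminal vertex. -/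
theorem exists_isTerminal (hT : T.IsTree) {v a : V} (hv : IsMajor T v) (ha : a ∈ legRoots T v) :
    ∃ u ∈ branch T v a, IsTerminal T u v ∧ ∀ x ∈ branch T v a, T.dist v x ≤ T.dist v u := by
  obtain ⟨hadj, hm⟩ := mem_legRoots.1 ha
  obtain ⟨u, hu, hmax⟩ := (branch T v a).exists_max_image (T.dist v) ⟨a, self_mem_branch hadj⟩
  refine ⟨u, hu, ⟨?_, hv, ?_⟩, hmax⟩
  · have huv : u ≠ v := by
      rintro rfl
      exact center_notMem_branch hu
    obtain ⟨b, hb, hbv⟩ := exists_mem_branch hT huv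
    -- By maximality of `u`, each of its neighbours is nearer to `v`, and only one can be.
    refine isLeaf_of_forall_eq hb fun c hc => eq_of_mem_branch hT hc hb ?_ hbv
    rw [mem_branch]
    rcases dist_lt_or_lt hT hc v with h | h
    · rcases eq_or_mem_branch_of_adj hT hadj hu hc with rfl | h'
      · rw [T.dist_self] at h
        omega
      · have := hmax c h'
        have c1 : T.dist v c = T.dist c v := T.dist_comm
        have c2 : T.dist v u = T.dist u v := T.dist_comm
        omega
    · exact h
  · intro w hw hne
    have h1 := dist_eq_add_of_mem_branch hT hadj hu fun h => hm w h hw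
    have h2 := hT.connected.pos_dist_of_ne hne
    have c1 : T.dist v u = T.dist u v := T.dist_comm
    have c2 : T.dist w u = T.dist u w := T.dist_comm
    omega

/-- The branch towards a terminal vertex is a leg. -/
theorem IsTerminal.mem_legRoots (hT : T.IsTree) {u v a : V} (hu : IsTerminal T u v)
    (ha : T.Adj v a) (hua : u ∈ branch T v a) : a ∈ legRoots T v := by
  refine FracKDim.mem_legRoots.2 ⟨ha, ?_⟩
  -- Induction along the path from `v` to `u`, with `q` just before `p`: being nearer to `u` than
  -- `v` is, `p` is not major, so its branch continues only towards `u` and stops there.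
  have key : ∀ n p q, T.Adj q p → u ∈ branch T q p → T.dist p u = n →
      T.dist p u < T.dist v u → ∀ w ∈ branch T q p, ¬ IsMajor T w := by
    intro n
    induction n with
    | zero =>
      intro p q hpq hup h0 _ w hw
      rw [hT.connected.dist_eq_zero_iff] at h0
      subst h0
      by_cases hpw : p = w
      · exact hpw ▸ hu.1.not_isMajor
      · obtain ⟨b, hb, hbv, -⟩ := exists_mem_branch_of_ne hT hw hpw
        exact absurd (hu.1.eq_of_adj hb hpq.symm) hbv
    | succ n ih =>
      intro p q hpq hup h0 hlt w hw
      have hpm : ¬ IsMajor T p := by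
        intro hp
        have := hu.2.2 p hp (by rintro rfl; omega)
        have c1 : T.dist v u = T.dist u v := T.dist_comm
        have c2 : T.dist p u = T.dist u p := T.dist_comm
        omega
      by_cases hpw : p = w
      · exact hpw ▸ hpm
      have hpu : p ≠ u := by
        rintro rfl
        simp at h0
      obtain ⟨b, hb, hbv, hwb⟩ := exists_mem_branch_of_ne hT hw hpw
      obtain ⟨c, hc, hcv, huc⟩ := exists_mem_branch_of_ne hT hup hpu
      obtain rfl : c = b :=
        (eq_or_eq_of_not_isMajor hpm hpq.symm hb hc hbv.symm).resolve_left hcv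
      have := dist_eq_add_one_of_lt hc (mem_branch.1 huc)
      exact ih c p hc huc (by omega) (by omega) w hwb
  exact key _ a v ha hua rfl (mem_branch.1 hua)

theorem IsTerminal.ne {u v : V} (hu : IsTerminal T u v) : v ≠ u := by
  rintro rfl
  exact hu.1.not_isMajor hu.2.1

/-- Otherwise `x` lies strictly between `v` and `y`, and its only neighbour would have to lead
towards both. -/
theorem eq_of_isLeaf_of_branch_not_isMajor (hT : T.IsTree) {v a x y : V} (ha : T.Adj v a)
    (hm : ∀ w ∈ branch T v a, ¬ IsMajor T w) (hx : x ∈ branch T v a) (hy : y ∈ branch T v a)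
    (hxl : IsLeaf T x) (hxy : T.dist v x ≤ T.dist v y) : x = y := by
  by_contra hne
  have h := dist_add_of_branch_not_isMajor hT ha hm hx hy hxy
  obtain ⟨b, hb, hby⟩ := exists_mem_branch hT hne
  have hxv : x ≠ v := by
    rintro rfl
    exact center_notMem_branch hx
  obtain ⟨c, hc, hcv⟩ := exists_mem_branch hT hxv
  obtain rfl := hxl.eq_of_adj hb hc
  have h1 := dist_eq_add_one_of_lt hb (mem_branch.1 hby)
  have h2 := dist_eq_add_one_of_lt hb (mem_branch.1 hcv)
  have h3 := hT.connected.dist_triangle (u := v) (v := b) (w := y)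
  have c1 : T.dist v b = T.dist b v := T.dist_comm
  have c2 : T.dist v x = T.dist x v := T.dist_comm
  omega

/-- Each leg corresponds to its far end, the only leaf on it. -/
theorem terminalDegree_eq_card_legRoots (hT : T.IsTree) {v : V} (hv : IsMajor T v) :
    terminalDegree T v = (legRoots T v).card := by
  classical
  unfold terminalDegree
  choose! f hf using fun a (ha : a ∈ legRoots T v) => exists_isTerminal hT hv ha
  symm
  refine Finset.card_bij (fun a _ => f a) ?_ ?_ ?_
  · intro a ha
    exact Finset.mem_filter.2 ⟨Finset.mem_univ _, (hf a ha).2.1⟩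
  · intro a ha b hb hab
    have h1 := (hf a ha).1
    rw [hab] at h1
    exact eq_of_mem_branch hT (adj_of_mem_legRoots ha) (adj_of_mem_legRoots hb) h1 (hf b hb).1
  · intro u hu
    have hu : IsTerminal T u v := (Finset.mem_filter.1 hu).2
    obtain ⟨a, ha, hua⟩ := exists_mem_branch hT hu.ne
    have hal := hu.mem_legRoots hT ha hua
    refine ⟨a, hal, ?_⟩
    exact (eq_of_isLeaf_of_branch_not_isMajor hT ha (mem_legRoots.1 hal).2 hua (hf a hal).1 hu.1
      ((hf a hal).2.2 u hua)).symm

theorem mem_exteriorM (hT : T.IsTree) {v : V} :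
    v ∈ exteriorM T ↔ IsMajor T v ∧ 2 ≤ (legRoots T v).card := by
  classical
  simp only [exteriorM, exteriorMajor, Finset.mem_filter, Finset.mem_univ, true_and]
  constructor
  · rintro ⟨⟨h1, -⟩, h2⟩
    exact ⟨h1, terminalDegree_eq_card_legRoots hT h1 ▸ h2⟩
  · rintro ⟨h1, h2⟩
    rw [terminalDegree_eq_card_legRoots hT h1]
    exact ⟨⟨h1, by omega⟩, h2⟩

theorem mem_legVerts (hT : T.IsTree) {v x : V} (hv : IsMajor T v) :
    x ∈ legVerts T v ↔ x = v ∨ x ∈ legs T v := by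
  classical
  rw [legVerts, Finset.mem_filter, mem_legs]
  simp only [Finset.mem_univ, true_and]
  refine or_congr_right' fun hxv => ?_
  constructor
  · rintro ⟨u, hu, hp⟩
    rw [mem_support_iff_dist hT] at hp
    obtain ⟨a, ha, hxa⟩ := exists_mem_branch hT (Ne.symm hxv)
    refine ⟨a, hu.mem_legRoots hT ha ?_, hxa⟩
    rw [mem_branch] at hxa ⊢
    have := hT.connected.dist_triangle (u := a) (v := x) (w := u)
    omega
  · rintro ⟨a, ha, hxa⟩
    obtain ⟨u, hua, hu, hmax⟩ := exists_isTerminal hT hv ha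
    obtain ⟨hadj, hm⟩ := mem_legRoots.1 ha
    refine ⟨u, hu, (mem_support_iff_dist hT).2 ?_⟩
    exact (dist_add_of_branch_not_isMajor hT hadj hm hxa hua (hmax x hxa)).symm

theorem center_notMem_legs {v : V} : v ∉ legs T v := by
  rw [mem_legs]
  rintro ⟨a, -, ha⟩
  exact center_notMem_branch ha

theorem branch_subset_legs {v a : V} (ha : a ∈ legRoots T v) : branch T v a ⊆ legs T v :=
  fun _ hz => mem_legs.2 ⟨a, ha, hz⟩

/-! ### Every pair is resolved by two legs -/

/-- Neither leg contains the other centre, so from a common vertex each of `v` and `w` would be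
reached through the other. -/
theorem disjoint_legs (hT : T.IsTree) {v w : V} (hv : IsMajor T v) (hw : IsMajor T w)
    (hvw : v ≠ w) : Disjoint (legs T v) (legs T w) := by
  refine Finset.disjoint_left.2 fun z h1 h2 => ?_
  obtain ⟨a, ha, hza⟩ := mem_legs.1 h1
  obtain ⟨b, hb, hzb⟩ := mem_legs.1 h2
  have d1 := dist_eq_add_of_mem_branch hT (adj_of_mem_legRoots ha) hza
    fun h => (mem_legRoots.1 ha).2 w h hw
  have d2 := dist_eq_add_of_mem_branch hT (adj_of_mem_legRoots hb) hzb
    fun h => (mem_legRoots.1 hb).2 v h hv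
  have := hT.connected.pos_dist_of_ne hvw
  have c1 : T.dist v w = T.dist w v := T.dist_comm
  omega

/-- A branch containing a major vertex contains two legs of some major vertex. -/
theorem exists_legs_subset_branch (hT : T.IsTree) {v a w : V} (ha : T.Adj v a)
    (hw : w ∈ branch T v a) (hm : IsMajor T w) :
    ∃ m, IsMajor T m ∧ ∃ c ∈ legRoots T m, ∃ d ∈ legRoots T m, c ≠ d ∧
      branch T m c ⊆ branch T v a ∧ branch T m d ⊆ branch T v a := by
  classical
  -- For a major vertex `m` farthest from `v`, every branch not leading back to `v` is a leg.
  obtain ⟨m, hmem, hmax⟩ := ((branch T v a).filter (IsMajor T)).exists_max_image (T.dist v)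
    ⟨w, Finset.mem_filter.2 ⟨hw, hm⟩⟩
  obtain ⟨hma, hmm⟩ := Finset.mem_filter.1 hmem
  have hmv : m ≠ v := by
    rintro rfl
    exact center_notMem_branch hma
  obtain ⟨p, hp, hvp⟩ := exists_mem_branch hT hmv
  have key : ∀ c, T.Adj m c → c ≠ p → c ∈ legRoots T m ∧ branch T m c ⊆ branch T v a := by
    intro c hc hcp
    have hv : v ∉ branch T m c := fun h => hcp (eq_of_mem_branch hT hc hp h hvp)
    have hsub := branch_subset_branch hT hc hma hv
    refine ⟨mem_legRoots.2 ⟨hc, fun z hz hzm => ?_⟩, hsub⟩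
    have h1 := hmax z (Finset.mem_filter.2 ⟨hsub hz, hzm⟩)
    have h2 := dist_eq_add_of_mem_branch hT hc hz hv
    rw [mem_branch] at hz
    omega
  obtain ⟨c, d, hc, hd, hcd, hcp, hdp⟩ := hmm.exists_adj_ne p
  exact ⟨m, hmm, c, (key c hc hcp).1, d, (key d hd hdp).1, hcd, (key c hc hcp).2,
    (key d hd hdp).2⟩

theorem two_le_card_legRoots {v a b : V} (ha : a ∈ legRoots T v) (hb : b ∈ legRoots T v)
    (hab : a ≠ b) : 2 ≤ (legRoots T v).card :=
  Finset.one_lt_card.2 ⟨a, ha, b, hb, hab⟩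

/-- In a tree with an exterior major vertex, any two vertices are resolved by two legs of some
major vertex. -/
theorem exists_legs_subset_resolvers (hT : T.IsTree) [DecidableEq V]
    (hex : (exteriorMajor T).Nonempty) {x y : V} (hxy : x ≠ y) :
    ∃ v ∈ exteriorM T, ∃ a ∈ legRoots T v, ∃ b ∈ legRoots T v, a ≠ b ∧
      branch T v a ∪ branch T v b ⊆ resolvers T x y := by
  classical
  obtain ⟨w, hw⟩ := hex
  simp only [exteriorMajor, Finset.mem_filter, Finset.mem_univ, true_and] at hw
  obtain ⟨hwm, hwt⟩ := hw
  have key : ∀ m a z, T.Adj m a → branch T m a ⊆ resolvers T x y → z ∈ branch T m a →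
      IsMajor T z → ∃ v ∈ exteriorM T, ∃ a ∈ legRoots T v, ∃ b ∈ legRoots T v, a ≠ b ∧
      branch T v a ∪ branch T v b ⊆ resolvers T x y := by
    intro m a z hadj hsub hz hzm
    obtain ⟨v, hv, c, hc, d, hd, hcd, h1, h2⟩ := exists_legs_subset_branch hT hadj hz hzm
    exact ⟨v, (mem_exteriorM hT).2 ⟨hv, two_le_card_legRoots hc hd hcd⟩, c, hc, d, hd, hcd,
      Finset.union_subset (h1.trans hsub) (h2.trans hsub)⟩
  rcases branches_subset_resolvers hT hxy with h | ⟨m, a, b, ha, hb, hab, -, -, hsub⟩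
  · obtain ⟨u, hu⟩ := Finset.card_pos.1 hwt
    have hu : IsTerminal T u w := (Finset.mem_filter.1 hu).2
    obtain ⟨a, ha, hwa⟩ := exists_mem_branch hT hu.ne.symm
    exact key u a w ha (fun z _ => h z) hwa hwm
  · have hsa := Finset.union_subset_left hsub
    have hsb := Finset.union_subset_right hsub
    by_cases hA : ∃ z ∈ branch T m a, IsMajor T z
    · obtain ⟨z, hz, hzm⟩ := hA
      exact key m a z ha hsa hz hzm
    by_cases hB : ∃ z ∈ branch T m b, IsMajor T z
    · obtain ⟨z, hz, hzm⟩ := hB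
      exact key m b z hb hsb hz hzm
    push Not at hA hB
    have hla : a ∈ legRoots T m := mem_legRoots.2 ⟨ha, hA⟩
    have hlb : b ∈ legRoots T m := mem_legRoots.2 ⟨hb, hB⟩
    -- Otherwise `m` and its two branches are the whole tree, with no room for `w`.
    have hmm : IsMajor T m := by
      by_contra hm
      have hne : m ≠ w := by
        rintro rfl
        exact hm hwm
      obtain ⟨c, hc, hwc⟩ := exists_mem_branch hT hne
      rcases eq_or_eq_of_not_isMajor hm ha hb hc hab with rfl | rfl
      · exact hA w hwc hwm
      · exact hB w hwc hwm
    exact ⟨m, (mem_exteriorM hT).2 ⟨hmm, two_le_card_legRoots hla hlb hab⟩, a, hla, b, hlb, hab,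
      hsub⟩

/-- Two vertices of `T_v` are resolved by two legs of `v`, or by all vertices but at most one,
which lies on a leg of `v`. -/
theorem legs_subset_resolvers_of_mem_legVerts (hT : T.IsTree) [DecidableEq V] {v x y : V}
    (hv : v ∈ exteriorM T) (hx : x ∈ legVerts T v) (hy : y ∈ legVerts T v) (hxy : x ≠ y) :
    (∃ a ∈ legRoots T v, ∃ b ∈ legRoots T v, a ≠ b ∧
      branch T v a ∪ branch T v b ⊆ resolvers T x y) ∨
    ∃ m ∈ legs T v, ∀ z, z ≠ m → z ∈ resolvers T x y := by
  obtain ⟨hvm, hcard⟩ := (mem_exteriorM hT).1 hv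
  -- Here `m` lies between `v` and `x`, so it is `v` or on the leg of `x`.
  have hleg : ∀ m a x, T.Adj m a → x ∈ branch T m a → x ∈ legVerts T v →
      v ∉ branch T m a → (v = m ∧ a ∈ legRoots T v) ∨ (v ≠ m ∧ m ∈ legs T v) := by
    intro m a x ha hxa hx hva
    have h1 := dist_eq_add_of_mem_branch hT ha hxa hva
    have hpos : 0 < T.dist m x := by
      rw [mem_branch] at hxa
      omega
    rw [mem_legVerts hT hvm, mem_legs] at hx
    obtain ⟨e, he, hxe⟩ := hx.resolve_left (by rintro rfl; simp at h1; omega)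
    have hae := adj_of_mem_legRoots he
    rcases eq_or_ne v m with rfl | hne
    · exact Or.inl ⟨rfl, eq_of_mem_branch hT ha hae hxa hxe ▸ he⟩
    · refine Or.inr ⟨hne, mem_legs.2 ⟨e, he, ?_⟩⟩
      by_contra hn
      have h2 := dist_eq_add_of_mem_branch hT hae hxe hn
      have := hT.connected.pos_dist_of_ne hne
      have c1 : T.dist m v = T.dist v m := T.dist_comm
      omega
  rcases branches_subset_resolvers hT hxy with h | ⟨m, a, b, ha, hb, hab, hxa, hyb, hsub⟩
  · right
    obtain ⟨c, hc⟩ : (legRoots T v).Nonempty := Finset.card_pos.1 (by omega)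
    exact ⟨c, branch_subset_legs hc (self_mem_branch (adj_of_mem_legRoots hc)), fun z _ => h z⟩
  -- A leg vertex is not major, so the two branches at `m` miss only `m`.
  · have hfin : m ∈ legs T v → ∃ m ∈ legs T v, ∀ z, z ≠ m → z ∈ resolvers T x y := by
      intro hm
      refine ⟨m, hm, fun z hz => hsub ?_⟩
      obtain ⟨e, he, hme⟩ := mem_legs.1 hm
      obtain ⟨c, hc, hzc⟩ := exists_mem_branch hT hz.symm
      rw [Finset.mem_union]
      rcases eq_or_eq_of_not_isMajor ((mem_legRoots.1 he).2 m hme) ha hb hc hab with rfl | rfl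
      · exact Or.inl hzc
      · exact Or.inr hzc
    by_cases hvb : v ∈ branch T m b
    · have hva : v ∉ branch T m a := fun h => hab (eq_of_mem_branch hT ha hb h hvb)
      rcases hleg m a x ha hxa hx hva with ⟨rfl, -⟩ | ⟨-, h⟩
      · exact absurd hvb center_notMem_branch
      · exact Or.inr (hfin h)
    · rcases hleg m b y hb hyb hy hvb with ⟨rfl, hbl⟩ | ⟨-, h⟩
      · rcases hleg v a x ha hxa hx center_notMem_branch with ⟨-, hal⟩ | ⟨h, -⟩
        · exact Or.inl ⟨a, hal, b, hbl, hab, hsub⟩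
        · exact absurd rfl h
      · exact Or.inr (hfin h)

/-! ### The subtrees `T_v` and the formula for κ -/

/-- A geodesic inside `T_v` cannot escape: from `v` it enters the leg of `y`, and a leg can be left
only through `v`. -/
theorem exists_adj_mem_legVerts (hT : T.IsTree) {v x y : V} (hv : IsMajor T v)
    (hx : x ∈ legVerts T v) (hy : y ∈ legVerts T v) (hxy : x ≠ y) :
    ∃ c ∈ legVerts T v, T.Adj x c ∧ T.dist x y = T.dist c y + 1 := by
  obtain ⟨c, hc, hyc⟩ := exists_mem_branch hT hxy
  refine ⟨c, ?_, hc, dist_eq_add_one_of_lt hc (mem_branch.1 hyc)⟩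
  rw [mem_legVerts hT hv] at hx hy ⊢
  rcases hx with rfl | hx
  · obtain ⟨e, he, hye⟩ := mem_legs.1 (hy.resolve_left hxy.symm)
    have hae := adj_of_mem_legRoots he
    obtain rfl := eq_of_mem_branch hT hc hae hyc hye
    exact Or.inr (branch_subset_legs he (self_mem_branch hae))
  · obtain ⟨e, he, hxe⟩ := mem_legs.1 hx
    exact (eq_or_mem_branch_of_adj hT (adj_of_mem_legRoots he) hxe hc).imp_right
      fun h => branch_subset_legs he h

/-- `T_v` is an isometric subgraph of `T`. -/
theorem dist_legTree (hT : T.IsTree) {v : V} (hv : IsMajor T v) (x y : legVerts T v) :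
    (legTree T v).dist x y = T.dist (x : V) y := by
  have key : ∀ n (x : legVerts T v), T.dist (x : V) y = n →
      ∃ p : (legTree T v).Walk x y, p.length = n := by
    intro n
    induction n with
    | zero =>
      intro x h
      rw [hT.connected.dist_eq_zero_iff] at h
      obtain rfl := Subtype.ext h
      exact ⟨Walk.nil, rfl⟩
    | succ n ih =>
      intro x h
      have hxy : (x : V) ≠ y := by
        intro h'
        rw [h', T.dist_self] at h
        omega
      obtain ⟨c, hc, hadj, hd⟩ := exists_adj_mem_legVerts hT hv x.2 y.2 hxy
      obtain ⟨p, hp⟩ := ih ⟨c, hc⟩ (by dsimp only; omega)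
      have hadj' : (legTree T v).Adj x ⟨c, hc⟩ := hadj
      exact ⟨Walk.cons hadj' p, by rw [Walk.length_cons, hp]⟩
  obtain ⟨p, hp⟩ := key _ x rfl
  refine le_antisymm (hp ▸ dist_le p) ?_
  obtain ⟨q, hq⟩ := p.reachable.exists_walk_length_eq_dist
  exact hq ▸ (dist_le (q.map (Embedding.induce (legVerts T v : Set V)).toHom)).trans_eq
    (Walk.length_map _ q)

theorem map_resolvers_legTree (hT : T.IsTree) [DecidableEq V] {v : V} (hv : IsMajor T v)
    (x y : legVerts T v) :
    (resolvers (legTree T v) x y).map (Function.Embedding.subtype _) =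
      legVerts T v ∩ resolvers T (x : V) y := by
  ext z
  simp only [Finset.mem_map, mem_resolvers, dist_legTree hT hv, Function.Embedding.subtype_apply,
    Finset.mem_inter]
  constructor
  · rintro ⟨w, hw, rfl⟩
    exact ⟨w.2, hw⟩
  · rintro ⟨h1, h2⟩
    exact ⟨⟨z, h1⟩, h2, rfl⟩

theorem sum_resolvers_legTree (hT : T.IsTree) [DecidableEq V] {v : V} (hv : IsMajor T v)
    (x y : legVerts T v) (g : V → ℝ) :
    ∑ z ∈ resolvers (legTree T v) x y, g z = ∑ z ∈ legVerts T v ∩ resolvers T (x : V) y, g z := by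
  rw [← map_resolvers_legTree hT hv, Finset.sum_map]
  rfl

theorem card_resolvers_legTree (hT : T.IsTree) [DecidableEq V] {v : V} (hv : IsMajor T v)
    (x y : legVerts T v) :
    (resolvers (legTree T v) x y).card = (legVerts T v ∩ resolvers T (x : V) y).card := by
  rw [← map_resolvers_legTree hT hv, Finset.card_map]

theorem legs_subset_legVerts (hT : T.IsTree) {v : V} (hv : IsMajor T v) :
    legs T v ⊆ legVerts T v :=
  fun _ hz => (mem_legVerts hT hv).2 (Or.inr hz)

theorem legVerts_eq_insert (hT : T.IsTree) [DecidableEq V] {v : V} (hv : IsMajor T v) :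
    legVerts T v = insert v (legs T v) := by
  ext z
  rw [mem_legVerts hT hv, Finset.mem_insert]

theorem kappa_le_card {W : Type*} [Fintype W] (G : SimpleGraph W) {x y : W} (h : x ≠ y) :
    kappa G ≤ (resolvers G x y).card :=
  Nat.sInf_le ⟨x, y, h, rfl⟩

theorem card_erase_legVerts (hT : T.IsTree) [DecidableEq V] {v m : V} (hv : IsMajor T v)
    (hm : m ∈ legs T v) : ((legVerts T v).erase m).card = (legs T v).card := by
  rw [Finset.card_erase_of_mem (legs_subset_legVerts hT hv hm), legVerts_eq_insert hT hv,
    Finset.card_insert_of_notMem center_notMem_legs, Nat.add_sub_cancel]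

theorem kappa_le_card_legs (hT : T.IsTree) [DecidableEq V] {v a b : V}
    (ha : a ∈ legRoots T v) (hb : b ∈ legRoots T v) (hab : a ≠ b) :
    kappa T ≤ (branch T v a ∪ branch T v b).card := by
  rw [← resolvers_adj hT (adj_of_mem_legRoots ha) (adj_of_mem_legRoots hb) hab]
  exact kappa_le_card T hab

/-- A pair in `T_v` resolved by all but one vertex has at least as many resolvers as the legs have
vertices, since only `v` is off the legs. -/
theorem kappa_le_kappa_legTree (hT : T.IsTree) {v : V} (hv : v ∈ exteriorM T) :
    kappa T ≤ kappa (legTree T v) := by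
  classical
  obtain ⟨hvm, hcard⟩ := (mem_exteriorM hT).1 hv
  obtain ⟨c, hc, d, hd, hcd⟩ := Finset.one_lt_card.1 hcard
  have hmem : ∀ a ∈ legRoots T v, a ∈ legVerts T v := fun a ha =>
    legs_subset_legVerts hT hvm (branch_subset_legs ha (self_mem_branch (adj_of_mem_legRoots ha)))
  have : Nontrivial (legVerts T v) :=
    ⟨⟨c, hmem c hc⟩, ⟨d, hmem d hd⟩, fun h => hcd (congrArg Subtype.val h)⟩
  obtain ⟨x, y, hxy, hxyc⟩ := (isLeast_kappa (legTree T v)).1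
  rw [← hxyc, card_resolvers_legTree hT hvm]
  rcases legs_subset_resolvers_of_mem_legVerts hT hv x.2 y.2 (fun h => hxy (Subtype.ext h)) with
    ⟨a, ha, b, hb, hab, hsub⟩ | ⟨m, hm, hres⟩
  · refine (kappa_le_card_legs hT ha hb hab).trans
      (Finset.card_le_card (Finset.subset_inter ?_ hsub))
    exact (Finset.union_subset (branch_subset_legs ha) (branch_subset_legs hb)).trans
      (legs_subset_legVerts hT hvm)
  · calc kappa T ≤ (branch T v c ∪ branch T v d).card := kappa_le_card_legs hT hc hd hcd
      _ ≤ (legs T v).card := Finset.card_le_card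
          (Finset.union_subset (branch_subset_legs hc) (branch_subset_legs hd))
      _ = ((legVerts T v).erase m).card := (card_erase_legVerts hT hvm hm).symm
      _ ≤ _ := Finset.card_le_card fun z hz => Finset.mem_inter.2
          ⟨Finset.mem_of_mem_erase hz, hres z (Finset.ne_of_mem_erase hz)⟩

theorem nontrivial_of_exteriorMajor_nonempty (hex : (exteriorMajor T).Nonempty) :
    Nontrivial V := by
  classical
  obtain ⟨w, hw⟩ := hex
  simp only [exteriorMajor, Finset.mem_filter, Finset.mem_univ, true_and] at hw
  obtain ⟨u, hu⟩ := Finset.card_pos.1 hw.2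
  exact ⟨w, u, (Finset.mem_filter.1 hu).2.ne⟩

theorem resolvers_legTree_roots (hT : T.IsTree) [DecidableEq V] {v a b : V} (hv : IsMajor T v)
    (ha : a ∈ legRoots T v) (hb : b ∈ legRoots T v) (hab : a ≠ b) :
    legVerts T v ∩ resolvers T a b = branch T v a ∪ branch T v b := by
  rw [resolvers_adj hT (adj_of_mem_legRoots ha) (adj_of_mem_legRoots hb) hab,
    Finset.inter_eq_right]
  exact (Finset.union_subset (branch_subset_legs ha) (branch_subset_legs hb)).trans
    (legs_subset_legVerts hT hv)

theorem root_mem_legVerts (hT : T.IsTree) {v a : V} (hv : IsMajor T v)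
    (ha : a ∈ legRoots T v) : a ∈ legVerts T v :=
  legs_subset_legVerts hT hv (branch_subset_legs ha (self_mem_branch (adj_of_mem_legRoots ha)))

theorem isLeast_kappa_legTree (hT : T.IsTree) (hex : (exteriorMajor T).Nonempty) :
    IsLeast ((fun v => kappa (legTree T v)) '' (exteriorM T : Set V)) (kappa T) := by
  classical
  have := nontrivial_of_exteriorMajor_nonempty hex
  refine ⟨?_, ?_⟩
  · obtain ⟨x, y, hxy, hc⟩ := (isLeast_kappa T).1
    obtain ⟨v, hv, a, ha, b, hb, hab, hsub⟩ := exists_legs_subset_resolvers hT hex hxy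
    have hvm := ((mem_exteriorM hT).1 hv).1
    refine ⟨v, hv, le_antisymm ?_ (kappa_le_kappa_legTree hT hv)⟩
    have h := kappa_le_card (legTree T v) (x := ⟨a, root_mem_legVerts hT hvm ha⟩)
      (y := ⟨b, root_mem_legVerts hT hvm hb⟩) (fun h => hab (congrArg Subtype.val h))
    rw [card_resolvers_legTree hT hvm, resolvers_legTree_roots hT hvm ha hb hab] at h
    exact hc ▸ h.trans (Finset.card_le_card hsub)
  · rintro _ ⟨v, hv, rfl⟩
    exact kappa_le_kappa_legTree hT hv

/-! ### Reduction to weights of pairs of legs -/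

open Classical in
/-- Any two legs at `v` have `g`-weight at least `k`. -/
def LegsResolve (G : SimpleGraph V) (k : ℝ) (g : V → ℝ) (v : V) : Prop :=
  ∀ a ∈ legRoots G v, ∀ b ∈ legRoots G v, a ≠ b → k ≤ ∑ z ∈ branch G v a ∪ branch G v b, g z

theorem LegsResolve.congr {k : ℝ} {g h : V → ℝ} {v : V} (hg : LegsResolve T k g v)
    (hgh : ∀ z ∈ legs T v, g z = h z) : LegsResolve T k h v := by
  classical
  intro a ha b hb hab
  refine (hg a ha b hb hab).trans_eq (Finset.sum_congr rfl fun z hz => hgh z ?_)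
  exact Finset.union_subset (branch_subset_legs ha) (branch_subset_legs hb) hz

theorem isKResolving_iff_legsResolve (hT : T.IsTree) (hex : (exteriorMajor T).Nonempty) {k : ℝ}
    {g : V → ℝ} : IsKResolving T k g ↔
      (∀ v, g v ∈ Set.Icc (0 : ℝ) 1) ∧ ∀ v ∈ exteriorM T, LegsResolve T k g v := by
  classical
  refine and_congr_right fun h01 => ⟨fun h v _ a ha b hb hab => ?_, fun h x y hxy => ?_⟩
  · have := h a b hab
    rwa [resolvers_adj hT (adj_of_mem_legRoots ha) (adj_of_mem_legRoots hb) hab] at this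
  · obtain ⟨v, hv, a, ha, b, hb, hab, hsub⟩ := exists_legs_subset_resolvers hT hex hxy
    exact (h v hv a ha b hb hab).trans
      (Finset.sum_le_sum_of_subset_of_nonneg hsub fun z _ _ => (h01 z).1)

theorem legsResolve_of_isKResolving_legTree (hT : T.IsTree) {v : V} (hv : IsMajor T v) {k : ℝ}
    {g : V → ℝ} (h : IsKResolving (legTree T v) k fun z => g z) : LegsResolve T k g v := by
  classical
  intro a ha b hb hab
  have := h.2 ⟨a, root_mem_legVerts hT hv ha⟩ ⟨b, root_mem_legVerts hT hv hb⟩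
    fun h => hab (congrArg Subtype.val h)
  rw [sum_resolvers_legTree hT hv] at this
  exact this.trans_eq (by rw [← resolvers_legTree_roots hT hv ha hb hab])

/-- The third leg is essential: the exceptional vertex spoils one leg, and two must remain. -/
theorem isKResolving_legTree (hT : T.IsTree) {v : V} (hv : v ∈ exteriorM T)
    (h3 : 3 ≤ (legRoots T v).card) {k : ℝ} {g : V → ℝ} (h01 : ∀ v, g v ∈ Set.Icc (0 : ℝ) 1)
    (h : LegsResolve T k g v) : IsKResolving (legTree T v) k fun z => g z := by
  classical
  have hvm := ((mem_exteriorM hT).1 hv).1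
  refine ⟨fun z => h01 z, fun x y hxy => ?_⟩
  rw [sum_resolvers_legTree hT hvm]
  have key : ∃ a ∈ legRoots T v, ∃ b ∈ legRoots T v, a ≠ b ∧
      branch T v a ∪ branch T v b ⊆ resolvers T (x : V) y := by
    rcases legs_subset_resolvers_of_mem_legVerts hT hv x.2 y.2 (fun h => hxy (Subtype.ext h)) with
      h | ⟨m, hm, hres⟩
    · exact h
    · obtain ⟨e, he, hme⟩ := mem_legs.1 hm
      have h1 : 1 < ((legRoots T v).erase e).card := by
        rw [Finset.card_erase_of_mem he]
        omega
      obtain ⟨a, ha, b, hb, hab⟩ := Finset.one_lt_card.1 h1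
      have hd : ∀ a ∈ (legRoots T v).erase e, branch T v a ⊆ resolvers T (x : V) y := by
        intro a ha z hz
        refine hres z ?_
        rintro rfl
        exact Finset.ne_of_mem_erase ha (eq_of_mem_branch hT
          (adj_of_mem_legRoots (Finset.mem_of_mem_erase ha)) (adj_of_mem_legRoots he) hz hme)
      exact ⟨a, Finset.mem_of_mem_erase ha, b, Finset.mem_of_mem_erase hb, hab,
        Finset.union_subset (hd a ha) (hd b hb)⟩
  obtain ⟨a, ha, b, hb, hab, hsub⟩ := key
  refine (h a ha b hb hab).trans
    (Finset.sum_le_sum_of_subset_of_nonneg ?_ fun z _ _ => (h01 z).1)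
  refine Finset.subset_inter ?_ hsub
  exact (Finset.union_subset (branch_subset_legs ha) (branch_subset_legs hb)).trans
    (legs_subset_legVerts hT hvm)

theorem legs_eq_of_card_eq_two [DecidableEq V] {v : V} (h : (legRoots T v).card = 2) :
    ∃ a ∈ legRoots T v, ∃ b ∈ legRoots T v, a ≠ b ∧
      legs T v = branch T v a ∪ branch T v b ∧ legRoots T v = {a, b} := by
  obtain ⟨a, b, hab, he⟩ := Finset.card_eq_two.1 h
  refine ⟨a, by simp [he], b, by simp [he], hab, ?_, he⟩
  ext z
  rw [mem_legs, he]
  simp only [Finset.mem_insert, Finset.mem_singleton, exists_eq_or_imp, exists_eq_left,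
    Finset.mem_union]

/-! ### Optimal weights at one vertex and their sum -/

/-- The least weight that the legs at `v` can have in a `k`-resolving function. -/
noncomputable def legsDim (G : SimpleGraph V) (k : ℝ) (v : V) : ℝ :=
  if terminalDegree G v = 2 then k else fracKDim (legTree G v) k

theorem legsDim_le (hT : T.IsTree) {v : V} (hv : v ∈ exteriorM T) {k : ℝ}
    (hk : k ≤ (kappa T : ℝ)) {g : V → ℝ} (h01 : ∀ v, g v ∈ Set.Icc (0 : ℝ) 1)
    (h : LegsResolve T k g v) : legsDim T k v ≤ ∑ z ∈ legs T v, g z := by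
  classical
  obtain ⟨hvm, hcard⟩ := (mem_exteriorM hT).1 hv
  rw [legsDim, terminalDegree_eq_card_legRoots hT hvm]
  split_ifs with h2
  · obtain ⟨a, ha, b, hb, hab, hl, -⟩ := legs_eq_of_card_eq_two h2
    rw [hl]
    exact h a ha b hb hab
  · have hk' : k ≤ (kappa (legTree T v) : ℝ) :=
      hk.trans (Nat.cast_le.2 (kappa_le_kappa_legTree hT hv))
    have hne : ∀ z ∈ legs T v, z ≠ v := fun z hz hzv => center_notMem_legs (hzv ▸ hz)
    -- Since `v` is in `T_v` but on no leg, setting its weight to zero keeps all leg constraints and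
    -- makes the total on `T_v` equal that on the legs.
    set g' := Function.update g v 0 with hg'
    have h01' : ∀ z, g' z ∈ Set.Icc (0 : ℝ) 1 := by
      intro z
      by_cases hz : z = v
      · simp [hg', hz]
      · rw [hg', Function.update_of_ne hz]
        exact h01 z
    have heq : ∀ z ∈ legs T v, g z = g' z := fun z hz => by
      rw [hg', Function.update_of_ne (hne z hz)]
    have hres := isKResolving_legTree hT hv (by omega) h01' (h.congr heq)
    refine ((isLeast_fracKDim _ hk').2 ⟨_, hres, rfl⟩).trans_eq ?_
    dsimp only
    rw [Finset.sum_coe_sort (legVerts T v) g', legVerts_eq_insert hT hvm,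
      Finset.sum_insert center_notMem_legs, hg', Function.update_self, zero_add]
    exact Finset.sum_congr rfl fun z hz => (heq z hz).symm

theorem exists_sum_legs_le_legsDim (hT : T.IsTree) {v : V} (hv : v ∈ exteriorM T) {k : ℝ}
    (hk0 : 0 ≤ k) (hk : k ≤ (kappa T : ℝ)) :
    ∃ g : V → ℝ, (∀ v, g v ∈ Set.Icc (0 : ℝ) 1) ∧ LegsResolve T k g v ∧
      ∑ z ∈ legs T v, g z ≤ legsDim T k v := by
  classical
  obtain ⟨hvm, hcard⟩ := (mem_exteriorM hT).1 hv
  rw [legsDim, terminalDegree_eq_card_legRoots hT hvm]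
  split_ifs with h2
  · obtain ⟨a, ha, b, hb, hab, hl, he⟩ := legs_eq_of_card_eq_two h2
    have hle : k ≤ ((legs T v).card : ℝ) := by
      rw [hl]
      exact hk.trans (Nat.cast_le.2 (kappa_le_card_legs hT ha hb hab))
    have hpos : (0 : ℝ) < ((legs T v).card : ℝ) := Nat.cast_pos.2
      (Finset.card_pos.2 ⟨a, branch_subset_legs ha (self_mem_branch (adj_of_mem_legRoots ha))⟩)
    have hsum : ∑ z ∈ legs T v, k / ((legs T v).card : ℝ) = k := by
      rw [Finset.sum_const, nsmul_eq_mul]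
      field_simp
    -- Spreading `k` evenly over the two legs stays below 1 because `k ≤ κ(T)` and κ(T) is at most
    -- their size.
    refine ⟨fun _ => k / ((legs T v).card : ℝ), fun _ => ⟨by positivity, ?_⟩, ?_, hsum.le⟩
    · exact (div_le_one hpos).2 hle
    · intro c hc d hd hcd
      have : branch T v c ∪ branch T v d = legs T v := by
        rw [he, Finset.mem_insert, Finset.mem_singleton] at hc hd
        rcases hc with rfl | rfl <;> rcases hd with rfl | rfl
        · exact absurd rfl hcd
        · exact hl.symm
        · rw [hl, Finset.union_comm]
        · exact absurd rfl hcd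
      exact hsum.ge.trans_eq (by rw [← this])
  · have hk' : k ≤ (kappa (legTree T v) : ℝ) :=
      hk.trans (Nat.cast_le.2 (kappa_le_kappa_legTree hT hv))
    obtain ⟨h, hres, hsum⟩ := (isLeast_fracKDim _ hk').1
    set g : V → ℝ := fun z => if hz : z ∈ legVerts T v then h ⟨z, hz⟩ else 0 with hg
    have hgh : (fun z : legVerts T v => g z) = h := by
      funext z
      simp [hg]
    have h01 : ∀ z, g z ∈ Set.Icc (0 : ℝ) 1 := by
      intro z
      by_cases hz : z ∈ legVerts T v
      · simpa only [hg, dif_pos hz] using hres.1 ⟨z, hz⟩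
      · simp [hg, hz]
    refine ⟨g, h01, legsResolve_of_isKResolving_legTree hT hvm (by rw [hgh]; exact hres), ?_⟩
    rw [← hsum, ← hgh]
    dsimp only
    rw [Finset.sum_coe_sort (legVerts T v) g]
    exact Finset.sum_le_sum_of_subset_of_nonneg (legs_subset_legVerts hT hvm)
      fun z _ _ => (h01 z).1

theorem fracKDim_eq_sum_legsDim (hT : T.IsTree) (hex : (exteriorMajor T).Nonempty) {k : ℝ}
    (hk0 : 0 ≤ k) (hk : k ≤ (kappa T : ℝ)) :
    fracKDim T k = ∑ v ∈ exteriorM T, legsDim T k v := by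
  classical
  have hdisj : ∀ v ∈ exteriorM T, ∀ w ∈ exteriorM T, v ≠ w → Disjoint (legs T v) (legs T w) :=
    fun v hv w hw hvw =>
      disjoint_legs hT ((mem_exteriorM hT).1 hv).1 ((mem_exteriorM hT).1 hw).1 hvw
  obtain ⟨⟨g, hg, hgs⟩, hmin⟩ := isLeast_fracKDim T hk
  apply le_antisymm
  · choose! f hf using fun v (hv : v ∈ exteriorM T) => exists_sum_legs_le_legsDim hT hv hk0 hk
    -- The local optima are glued; by disjointness at most one summand survives at each `z`.
    set F : V → ℝ := fun z => ∑ v ∈ exteriorM T, if z ∈ legs T v then f v z else 0 with hF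
    have hFeq : ∀ v ∈ exteriorM T, ∀ z ∈ legs T v, f v z = F z := by
      intro v hv z hz
      rw [hF]
      dsimp only
      rw [Finset.sum_eq_single_of_mem v hv, if_pos hz]
      exact fun w hw hwv =>
        if_neg fun hzw => Finset.disjoint_left.1 (hdisj w hw v hv hwv) hzw hz
    have hF01 : ∀ z, F z ∈ Set.Icc (0 : ℝ) 1 := by
      intro z
      by_cases hz : ∃ v ∈ exteriorM T, z ∈ legs T v
      · obtain ⟨v, hv, hzv⟩ := hz
        rw [← hFeq v hv z hzv]
        exact (hf v hv).1 z
      · push Not at hz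
        have : F z = 0 := Finset.sum_eq_zero fun v hv => if_neg (hz v hv)
        simp [this]
    have hres : IsKResolving T k F := (isKResolving_iff_legsResolve hT hex).2
      ⟨hF01, fun v hv => (hf v hv).2.1.congr (hFeq v hv)⟩
    refine (hmin ⟨F, hres, rfl⟩).trans ?_
    simp only [hF]
    rw [Finset.sum_comm]
    refine Finset.sum_le_sum fun v hv => ?_
    rw [Finset.sum_ite_mem, Finset.univ_inter]
    exact (hf v hv).2.2
  · obtain ⟨h01, hl⟩ := (isKResolving_iff_legsResolve hT hex).1 hg
    rw [← hgs]
    calc ∑ v ∈ exteriorM T, legsDim T k v ≤ ∑ v ∈ exteriorM T, ∑ z ∈ legs T v, g z :=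
          Finset.sum_le_sum fun v hv => legsDim_le hT hv hk h01 (hl v hv)
      _ = ∑ z ∈ (exteriorM T).biUnion (legs T), g z :=
          (Finset.sum_biUnion fun v hv w hw hvw => hdisj v hv w hw hvw).symm
      _ ≤ ∑ z, g z := Finset.sum_le_sum_of_subset_of_nonneg (Finset.subset_univ _)
          fun z _ _ => (h01 z).1

theorem sum_legsDim (G : SimpleGraph V) (k : ℝ) :
    ∑ v ∈ exteriorM G, legsDim G k v =
      k * ((exteriorM₂ G).card : ℝ) + ∑ v ∈ exteriorM₃ G, fracKDim (legTree G v) k := by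
  classical
  rw [← Finset.sum_filter_add_sum_filter_not (exteriorM G) fun v => terminalDegree G v = 2]
  congr 1
  · rw [mul_comm, ← nsmul_eq_mul, ← Finset.sum_const]
    exact Finset.sum_congr rfl fun v hv => if_pos (Finset.mem_filter.1 hv).2
  · have : (exteriorM G).filter (fun v => ¬ terminalDegree G v = 2) = exteriorM₃ G := by
      refine Finset.filter_congr fun v hv => ?_
      have := (Finset.mem_filter.1 hv).2
      omega
    rw [this]
    refine Finset.sum_congr rfl fun v hv => if_neg ?_
    have := (Finset.mem_filter.1 hv).2
    omega

end FracKDim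

theorem mainTheorem2 {V : Type*} [Fintype V] (T : SimpleGraph V) (hT : T.IsTree)
    (hex : 1 ≤ (FracKDim.exteriorMajor T).card) :
    IsLeast ((fun v => FracKDim.kappa (FracKDim.legTree T v)) '' (FracKDim.exteriorM T : Set V))
      (FracKDim.kappa T) ∧
    ∀ k : ℝ, 1 ≤ k → k ≤ (FracKDim.kappa T : ℝ) →
      FracKDim.fracKDim T k = k * ((FracKDim.exteriorM₂ T).card : ℝ) +
        ∑ v ∈ FracKDim.exteriorM₃ T, FracKDim.fracKDim (FracKDim.legTree T v) k := by
  have hne := Finset.card_pos.1 hex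
  refine ⟨FracKDim.isLeast_kappa_legTree hT hne, fun k hk1 hk => ?_⟩
  rw [FracKDim.fracKDim_eq_sum_legsDim hT hne (zero_le_one.trans hk1) hk, FracKDim.sum_legsDim]
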